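/- Let $\Delta\subseteq\mathbb R^2$ be the filled triangle with vertices $(0,0),(1,0),(0,1)$, where $\mathbb R^2$ carries the Euclidean norm, and let $\mathcal F=(\mathbb R^2;f_1,f_2)$ be the Barnsley–Vince iterated function system $$f_1(v)=\begin{pmatrix}1&\tfrac12\\0&\tfrac12\end{pmatrix}v,\qquad f_2(v)=\begin{pmatrix}0&\tfrac12\\-1&-\tfrac12\end{pmatrix}v+\begin{pmatrix}0\\1\end{pmatrix}.$$ Let $F(S)=\overline{f_1(S)\cup f_2(S)}$ for $S\subseteq\mathbb R^2$. A nonempty closed set $A$ is *invariant* if $F(A)=A$, *minimal invariant* if moreover no nonempty closed proper subset of $A$ is invariant, and a *semiattractor* if $A=\bigcap_{x\in\mathbb R^2}\operatorname{Li}F^n(\{x\})$, where $\operatorname{Li}S_n$ is the set of limits of convergent sequences $x_n\in S_n$. The *fibre* of $A$ with address $(i_n)_{n\ge1}\in\{1,2\}^{\infty}$ is $\bigcap_{n\ge1}f_{i_1}\circ\dots\circ f_{i_n}(A)$; $A$ is *point-fibred* if all its fibres are singletons, and *strongly-fibred* if for every $a\in A$ every open set containing $a$ contains a fibre of $A$.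 For $p_1,p_2\ge0$ with $p_1+p_2=1$, an *invariant measure* is a Borel probability measure $\mu$ on $\mathbb R^2$ with $\mu=p_1\,\mu\circ f_1^{-1}+p_2\,\mu\circ f_2^{-1}$; the second iterate is *contractive on average* if $\sum_{i,j=1}^2p_ip_j\operatorname{Lip}(f_i\circ f_j)<1$, where $\operatorname{Lip}$ is the Lipschitz constant. Then: 1. $\Delta$ is a compact minimal invariant set and a semiattractor of $\mathcal F$ (on the whole plane). Moreover $f_i(\Delta)\subseteq\Delta$ for $i=1,2$, and $\Delta$ is a strict attractor of the restricted system $(\Delta;f_1|_\Delta,f_2|_\Delta)$, that is, $F^n(S)\to\Delta$ in the Hausdorff metric for every nonempty compact $S\subseteq\Delta$. 2. $\Delta$ is strongly-fibred but not point-fibred, and each of its fibres is a point or a line segment. 3. If $p_1=p_2=\tfrac12$, then the second iterate is contractive on average, normalized Lebesgue measure on $\Delta$, $\mu(B)=\mathcal L(B\cap\Delta)/\mathcal L(\Delta)$, is the unique invariant measure, and $\operatorname{supp}\mu=\Delta$. 4. If $0\le p_1<\dfrac{4-2\sqrt2}{\sqrt{3\sqrt{17}+13}-2\sqrt2}\approx0.53$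 and $p_2=1-p_1$, then the second iterate is contractive on average, and there is exactly one invariant measure; it is concentrated on $\Delta$, and its support is equal to $\Delta$ if $p_1>0$. -/

import Mathlib

open Set Filter Topology MeasureTheory
open scoped NNReal ENNReal Matrix

noncomputable section

/-- The lower Kuratowski limit of a sequence of sets `S n`, `n ≥ 1`. -/
def lowerKuratowskiLimit {X : Type*} [TopologicalSpace X] (S : ℕ → Set X) : Set X :=
  {y | ∃ x : ℕ → X, (∀ n, 1 ≤ n → x n ∈ S n) ∧ Tendsto x atTop (𝓝 y)}

/-- The Lipschitz constant of `f`, as an extended nonnegative real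
(it is `∞` when `f` is not Lipschitz). -/
def lipConst {X : Type*} [MetricSpace X] (f : X → X) : ℝ≥0∞ :=
  ⨆ (x : X) (y : X) (_ : x ≠ y), edist (f x) (f y) / edist x y

/-- An iterated function system: a family of continuous self-maps of `X`
(finiteness of the index type `ι` is imposed through `[Fintype ι]` where it matters). -/
structure IFS (X : Type*) [TopologicalSpace X] (ι : Type*) where
  map : ι → X → X
  continuous_map : ∀ i, Continuous (map i)

namespace IFS

variable {X : Type*} [TopologicalSpace X] {ι : Type*}

/-- The Hutchinson operator `S ↦ cl (⋃ i, f_i(S))`. -/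
def hutchinson (F : IFS X ι) (S : Set X) : Set X :=
  closure (⋃ i, F.map i '' S)

/-- A nonempty closed set `A` with `F(A) = A`. -/
def IsInvariant (F : IFS X ι) (A : Set X) : Prop :=
  A.Nonempty ∧ IsClosed A ∧ F.hutchinson A = A

/-- An invariant set with no nonempty closed invariant proper subset. -/
def IsMinimalInvariant (F : IFS X ι) (A : Set X) : Prop :=
  F.IsInvariant A ∧ ∀ C : Set X, F.IsInvariant C → ¬ C ⊂ A

/-- A nonempty closed set `A` with `⋂ x, Li Fⁿ({x}) = A`. -/
def IsSemiattractor (F : IFS X ι) (A : Set X) : Prop :=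
  A.Nonempty ∧ IsClosed A ∧
    ⋂ x : X, lowerKuratowskiLimit (fun n => F.hutchinson^[n] {x}) = A

/-- A nonempty closed set `A` that has an open neighbourhood `U` such that `Fⁿ(S) → A` in the
Hausdorff metric for all nonempty compact `S ⊆ U`. -/
def IsStrictAttractor {X : Type*} [MetricSpace X] (F : IFS X ι) (A : Set X) : Prop :=
  A.Nonempty ∧ IsClosed A ∧ ∃ U : Set X, IsOpen U ∧ A ⊆ U ∧
    ∀ S : Set X, S.Nonempty → IsCompact S → S ⊆ U →
      Tendsto (fun n => Metric.hausdorffEDist (F.hutchinson^[n] S) A) atTop (𝓝 0)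

/-- The restriction of an IFS to a set `C` which is mapped into itself by all the maps. -/
def restrict (F : IFS X ι) (C : Set X) (h : ∀ i, MapsTo (F.map i) C C) : IFS C ι where
  map i := (h i).restrict
  continuous_map i := (F.continuous_map i).restrict (h i)

/-- The composition `f_{w 0} ∘ f_{w 1} ∘ ⋯ ∘ f_{w (k-1)}` along a finite word `w`. -/
def wordMap (F : IFS X ι) : (k : ℕ) → (Fin k → ι) → X → X
  | 0, _ => id
  | k + 1, w => F.map (w 0) ∘ F.wordMap k (Fin.tail w)

theorem continuous_wordMap (F : IFS X ι) :
    ∀ (k : ℕ) (w : Fin k → ι), Continuous (F.wordMap k w)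
  | 0, _ => continuous_id
  | k + 1, w => (F.continuous_map (w 0)).comp (F.continuous_wordMap k (Fin.tail w))

/-- The fibre of `A` with address `c 0, c 1, …`, that is
`⋂_{n ≥ 1} f_{c 0} ∘ ⋯ ∘ f_{c (n-1)} (A)`. -/
def fibre (F : IFS X ι) (A : Set X) (c : ℕ → ι) : Set X :=
  ⋂ n : ℕ, F.wordMap (n + 1) (fun j => c j) '' A

/-- All fibres of `A` are singletons. -/
def IsPointFibred (F : IFS X ι) (A : Set X) : Prop :=
  ∀ c : ℕ → ι, ∃ a : X, F.fibre A c = {a}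

/-- Every open set which meets `A` contains a fibre of `A`. -/
def IsStronglyFibred (F : IFS X ι) (A : Set X) : Prop :=
  ∀ a ∈ A, ∀ V : Set X, IsOpen V → a ∈ V → ∃ c : ℕ → ι, F.fibre A c ⊆ V

end IFS

/-- A probabilistic IFS: a finite IFS with a vector of probabilities. -/
structure ProbIFS (X : Type*) [TopologicalSpace X] (ι : Type*) [Fintype ι] extends IFS X ι where
  prob : ι → ℝ≥0
  sum_prob : ∑ i, prob i = 1

namespace ProbIFS

/-- The Markov operator `μ ↦ ∑ i, p_i · μ ∘ f_i⁻¹`. -/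
def markov {X : Type*} [TopologicalSpace X] [MeasurableSpace X] {ι : Type*} [Fintype ι]
    (P : ProbIFS X ι) (μ : Measure X) : Measure X :=
  ∑ i, P.prob i • μ.map (P.map i)

/-- A probability measure fixed by the Markov operator. -/
def IsInvariantMeasure {X : Type*} [TopologicalSpace X] [MeasurableSpace X] {ι : Type*}
    [Fintype ι] (P : ProbIFS X ι) (μ : Measure X) : Prop :=
  IsProbabilityMeasure μ ∧ P.markov μ = μ

/-- The `k`-th iterate of a probabilistic IFS: all compositions along words of length `k`, with
the product probabilities. -/
def iterate {X : Type*} [TopologicalSpace X] {ι : Type*} [Fintype ι]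
    (P : ProbIFS X ι) (k : ℕ) : ProbIFS X (Fin k → ι) where
  map w := P.wordMap k w
  continuous_map w := P.continuous_wordMap k w
  prob w := ∏ l, P.prob (w l)
  sum_prob := by
    rw [← Fintype.sum_pow, P.sum_prob, one_pow]

/-- Contractivity on average: `∑ i, p_i · Lip(f_i) < 1`. -/
def IsAverageContractive {X : Type*} [MetricSpace X] {ι : Type*} [Fintype ι]
    (P : ProbIFS X ι) : Prop :=
  ∑ i, (P.prob i : ℝ≥0∞) * lipConst (P.map i) < 1

end ProbIFS

namespace BarnsleyVince

/-- The matrices `A₁` (index `0`) and `A₂` (index `1`). -/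
def mat : Fin 2 → Matrix (Fin 2) (Fin 2) ℝ :=
  ![!![1, 1 / 2; 0, 1 / 2], !![0, 1 / 2; -1, -1 / 2]]

/-- The Barnsley–Vince IFS on the Euclidean plane: `f₁(v) = A₁ v` (index `0`) and
`f₂(v) = A₂ v + (0, 1)` (index `1`). -/
def ifs : IFS (EuclideanSpace ℝ (Fin 2)) (Fin 2) where
  map i v := WithLp.toLp 2 (mat i *ᵥ v.ofLp) + !₂[0, ((i : ℕ) : ℝ)]
  continuous_map i := by fun_prop

/-- The Barnsley–Vince IFS with probabilities `p`. -/
def probIFS (p : Fin 2 → ℝ≥0) (hp : ∑ i, p i = 1) :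
    ProbIFS (EuclideanSpace ℝ (Fin 2)) (Fin 2) where
  toIFS := ifs
  prob := p
  sum_prob := hp

/-- The filled triangle with vertices `(0,0)`, `(1,0)`, `(0,1)`. -/
def triangle : Set (EuclideanSpace ℝ (Fin 2)) :=
  convexHull ℝ {!₂[0, 0], !₂[1, 0], !₂[0, 1]}

/-- Normalized Lebesgue measure on the triangle. -/
def lebesgueTriangle : Measure (EuclideanSpace ℝ (Fin 2)) :=
  (volume triangle)⁻¹ • volume.restrict triangle

end BarnsleyVince

end

/-! Neither map contracts the Euclidean norm, but the compositions of two maps contract on average.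
Hence the dual (transfer) operator of the second iterate shrinks Lipschitz constants geometrically,
and its iterates on a bounded Lipschitz function become asymptotically constant. Tested on
characters, this gives uniqueness of the invariant measure (`isInvariantMeasure_unique`) and, by
compactness, existence of one on every nonempty compact set that the maps send into itself
(`exists_isInvariantMeasure`). Both pass from the second iterate back to the system itself.

The topological claims rest on the measure. With equal probabilities, normalized Lebesgue measure is
invariant, since the maps halve areas and tile the triangle along its diagonal. A nonempty closed
forward-invariant subset of the triangle carries an invariant measure; by uniqueness this is
Lebesgue measure, so the subset is the whole triangle (`eq_triangle_of_mapsTo`).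

This rigidity is then applied to closed forward-invariant sets containing the attracting fixed point
of the second map: the part of the triangle in the lower limit of an orbit (semiattractor, strict
attractor), and the points all of whose neighbourhoods contain a fibre. It also gives minimality and
identifies supports. Fibres are compact, convex and, because areas halve at each step, collinear. -/

theorem edist_le_lipConst_mul {X : Type*} [MetricSpace X] (f : X → X) (x y : X) :
    edist (f x) (f y) ≤ lipConst f * edist x y := by
  rcases eq_or_ne x y with rfl | h
  · simp
  · have h1 : edist (f x) (f y) / edist x y ≤ lipConst f :=
      le_iSup_of_le x (le_iSup_of_le y (le_iSup_of_le h le_rfl))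
    rwa [ENNReal.div_le_iff (edist_pos.2 h).ne' (edist_ne_top x y)] at h1

theorem lipConst_le {X : Type*} [MetricSpace X] {f : X → X} {K : ℝ≥0∞}
    (h : ∀ x y, edist (f x) (f y) ≤ K * edist x y) : lipConst f ≤ K :=
  iSup_le fun x => iSup_le fun y => iSup_le fun hxy =>
    (ENNReal.div_le_iff (edist_pos.2 hxy).ne' (edist_ne_top x y)).2 (h x y)

namespace ProbIFS

/-! ### The transfer operator on functions -/

section Transfer

variable {X : Type*} {ι : Type*} [Fintype ι]

/-- The action of a probabilistic IFS on functions, dual to the Markov operator. -/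
noncomputable def transfer [TopologicalSpace X] (P : ProbIFS X ι) (f : X → ℂ) (x : X) : ℂ :=
  ∑ i, (P.prob i : ℝ) • f (P.map i x)

theorem continuous_transfer [TopologicalSpace X] (P : ProbIFS X ι) {f : X → ℂ} (hf : Continuous f) :
    Continuous (P.transfer f) := by
  unfold transfer
  have := P.continuous_map
  fun_prop

theorem sum_coe_prob [TopologicalSpace X] (P : ProbIFS X ι) : ∑ i, (P.prob i : ℝ) = 1 := by
  rw [← NNReal.coe_sum, P.sum_prob, NNReal.coe_one]

theorem norm_transfer_le [TopologicalSpace X] (P : ProbIFS X ι) {f : X → ℂ} {K : ℝ}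
    (hf : ∀ x, ‖f x‖ ≤ K) (x : X) :
    ‖P.transfer f x‖ ≤ K := by
  calc ‖P.transfer f x‖ ≤ ∑ i, ‖(P.prob i : ℝ) • f (P.map i x)‖ := norm_sum_le _ _
    _ ≤ ∑ i, (P.prob i : ℝ) * K := by
      refine Finset.sum_le_sum fun i _ => ?_
      rw [norm_smul, Real.norm_of_nonneg (P.prob i).coe_nonneg]
      exact mul_le_mul_of_nonneg_left (hf _) (P.prob i).coe_nonneg
    _ = K := by rw [← Finset.sum_mul, P.sum_coe_prob, one_mul]

theorem continuous_transfer_iterate [TopologicalSpace X] (P : ProbIFS X ι) {f : X → ℂ}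
    (hf : Continuous f) (n : ℕ) :
    Continuous (P.transfer^[n] f) := by
  induction n with
  | zero => exact hf
  | succ n ih => rw [Function.iterate_succ_apply']; exact P.continuous_transfer ih

theorem norm_transfer_iterate_le [TopologicalSpace X] (P : ProbIFS X ι) {f : X → ℂ} {K : ℝ}
    (hf : ∀ x, ‖f x‖ ≤ K)
    (n : ℕ) : ∀ x, ‖P.transfer^[n] f x‖ ≤ K := by
  induction n with
  | zero => exact hf
  | succ n ih => rw [Function.iterate_succ_apply']; exact P.norm_transfer_le ih

/-- Only the average of the Lipschitz constants enters, so single maps may expand. -/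
theorem edist_transfer_le [MetricSpace X] (P : ProbIFS X ι) {f : X → ℂ} {K : ℝ≥0∞}
    (hf : ∀ x y, edist (f x) (f y) ≤ K * edist x y) (x y : X) :
    edist (P.transfer f x) (P.transfer f y) ≤
      ((∑ i, (P.prob i : ℝ≥0∞) * lipConst (P.map i)) * K) * edist x y := by
  rw [edist_eq_enorm_sub, transfer, transfer, ← Finset.sum_sub_distrib, Finset.sum_mul,
    Finset.sum_mul]
  refine (enorm_sum_le _ _).trans (Finset.sum_le_sum fun i _ => ?_)
  rw [← smul_sub, enorm_smul, ← edist_eq_enorm_sub, NNReal.enorm_eq]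
  calc (P.prob i : ℝ≥0∞) * edist (f (P.map i x)) (f (P.map i y))
      ≤ P.prob i * (K * (lipConst (P.map i) * edist x y)) := by
        gcongr
        exact (hf _ _).trans (mul_le_mul_right (edist_le_lipConst_mul _ _ _) _)
    _ = _ := by ring

theorem tendsto_edist_transfer_iterate [MetricSpace X] (P : ProbIFS X ι) (hP : P.IsAverageContractive)
    {f : X → ℂ} {K : ℝ≥0} (hf : LipschitzWith K f) (x y : X) :
    Tendsto (fun n => edist (P.transfer^[n] f x) (P.transfer^[n] f y)) atTop (𝓝 0) := by
  set q := ∑ i, (P.prob i : ℝ≥0∞) * lipConst (P.map i) with hq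
  have key : ∀ n, ∀ x y, edist (P.transfer^[n] f x) (P.transfer^[n] f y) ≤
      (q ^ n * K) * edist x y := by
    intro n
    induction n with
    | zero => intro x y; simpa using hf x y
    | succ n ih =>
      intro x y
      rw [Function.iterate_succ_apply']
      refine (P.edist_transfer_le ih x y).trans (le_of_eq ?_)
      rw [pow_succ]; ring
  refine tendsto_of_tendsto_of_tendsto_of_le_of_le tendsto_const_nhds ?_
    (fun n => zero_le) (fun n => key n x y)
  have h0 : Tendsto (fun n => q ^ n) atTop (𝓝 0) := ENNReal.tendsto_pow_atTop_nhds_zero_of_lt_one hP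
  have h1 := ENNReal.Tendsto.mul_const h0 (b := K * edist x y)
    (Or.inr (ENNReal.mul_ne_top ENNReal.coe_ne_top (edist_ne_top x y)))
  simpa [mul_assoc] using h1

theorem tendsto_transfer_iterate_sub [MetricSpace X] (P : ProbIFS X ι) (hP : P.IsAverageContractive)
    {f : X → ℂ} {K : ℝ≥0} (hf : LipschitzWith K f) (x y : X) :
    Tendsto (fun n => P.transfer^[n] f x - P.transfer^[n] f y) atTop (𝓝 0) := by
  rw [tendsto_zero_iff_norm_tendsto_zero]
  have := (ENNReal.tendsto_toReal ENNReal.zero_ne_top).comp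
    (P.tendsto_edist_transfer_iterate hP hf x y)
  simpa [Function.comp_def, ← dist_eq_norm, dist_edist] using this

end Transfer

/-! ### The Markov operator and its duality with the transfer operator -/

section Markov

variable {X : Type*} [TopologicalSpace X] [MeasurableSpace X] [BorelSpace X]
  {ι : Type*} [Fintype ι]

theorem isProbabilityMeasure_markov (P : ProbIFS X ι) (μ : Measure X) [IsProbabilityMeasure μ] :
    IsProbabilityMeasure (P.markov μ) := by
  constructor
  have h : ∀ i, μ.map (P.map i) univ = 1 := fun i => by
    rw [Measure.map_apply (P.continuous_map i).measurable MeasurableSet.univ]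
    simp
  simp only [markov, Measure.coe_finsetSum, Finset.sum_apply, Measure.smul_apply, h]
  simp only [ENNReal.smul_def, smul_eq_mul, mul_one]
  rw [← ENNReal.ofNNReal_finsetSum, P.sum_prob, ENNReal.coe_one]

theorem markov_compl_eq_zero (P : ProbIFS X ι) {μ : Measure X} {C : Set X} (hC : MeasurableSet C)
    (h : ∀ i, MapsTo (P.map i) C C) (hμ : μ Cᶜ = 0) : P.markov μ Cᶜ = 0 := by
  simp only [markov, Measure.coe_finsetSum, Finset.sum_apply, Measure.smul_apply]
  refine Finset.sum_eq_zero fun i _ => ?_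
  rw [Measure.map_apply (P.continuous_map i).measurable hC.compl,
    measure_mono_null (fun x hx hxC => hx (h i hxC) : P.map i ⁻¹' Cᶜ ⊆ Cᶜ) hμ, smul_zero]

theorem markov_iterate_two (P : ProbIFS X ι) (μ : Measure X) :
    (P.iterate 2).markov μ = P.markov (P.markov μ) := by
  have hm : ∀ i, Measurable (P.map i) := fun i => (P.continuous_map i).measurable
  have h1 : P.markov (P.markov μ) =
      ∑ i, ∑ j, (P.prob i * P.prob j) • μ.map (P.map i ∘ P.map j) := by
    unfold markov
    refine Finset.sum_congr rfl fun i _ => ?_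
    ext s hs
    simp only [Measure.smul_apply, Measure.map_apply (hm i) hs, Measure.coe_finsetSum,
      Finset.sum_apply, Measure.map_apply ((hm i).comp (hm _)) hs,
      Measure.map_apply (hm _) (hm i hs), Finset.smul_sum, smul_smul, preimage_comp]
  rw [h1, ← Fintype.sum_prod_type', markov]
  refine Fintype.sum_equiv (finTwoArrowEquiv ι) _ _ fun w => ?_
  simp [iterate, IFS.wordMap, Fin.tail, Fin.prod_univ_two, finTwoArrowEquiv]

theorem integral_markov (P : ProbIFS X ι) (μ : Measure X) [IsFiniteMeasure μ] {f : X → ℂ}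
    (hf : Continuous f) {K : ℝ} (hK : ∀ x, ‖f x‖ ≤ K) :
    ∫ x, f x ∂(P.markov μ) = ∫ x, P.transfer f x ∂μ := by
  have hint : ∀ ν : Measure X, IsFiniteMeasure ν → ∀ g : X → ℂ, Continuous g →
      (∀ x, ‖g x‖ ≤ K) → Integrable g ν := fun ν _ g hg hgK =>
    Integrable.of_bound hg.measurable.aestronglyMeasurable K (Eventually.of_forall hgK)
  unfold markov transfer
  rw [integral_finsetSum_measure, integral_finsetSum]
  · refine Finset.sum_congr rfl fun i _ => ?_
    rw [integral_smul_nnreal_measure, integral_smul,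
      integral_map (P.continuous_map i).aemeasurable hf.measurable.aestronglyMeasurable]
    rfl
  · exact fun i _ =>
      Integrable.fun_smul _ (hint μ inferInstance _ (hf.comp (P.continuous_map i)) fun x => hK _)
  · exact fun i _ => hint _ inferInstance _ hf hK

theorem isProbabilityMeasure_markov_iterate (P : ProbIFS X ι) (μ : Measure X)
    [IsProbabilityMeasure μ] (n : ℕ) : IsProbabilityMeasure (P.markov^[n] μ) := by
  induction n with
  | zero => assumption
  | succ n ih => rw [Function.iterate_succ_apply']; exact P.isProbabilityMeasure_markov _

theorem integral_markov_iterate (P : ProbIFS X ι) (n : ℕ) : ∀ (μ : Measure X)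
    [IsProbabilityMeasure μ] {f : X → ℂ} (_ : Continuous f) {K : ℝ} (_ : ∀ x, ‖f x‖ ≤ K),
    ∫ x, f x ∂(P.markov^[n] μ) = ∫ x, P.transfer^[n] f x ∂μ := by
  induction n with
  | zero => intros; rfl
  | succ n ih =>
    intro μ _ f hf K hK
    have := P.isProbabilityMeasure_markov_iterate μ n
    rw [Function.iterate_succ_apply', integral_markov P _ hf hK,
      ih μ (P.continuous_transfer hf) (P.norm_transfer_le hK), ← Function.iterate_succ_apply]

theorem IsInvariantMeasure.iterate_two {P : ProbIFS X ι} {μ : Measure X}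
    (hμ : P.IsInvariantMeasure μ) : (P.iterate 2).IsInvariantMeasure μ :=
  ⟨hμ.1, by rw [markov_iterate_two, hμ.2, hμ.2]⟩

end Markov

/-! ### Integrals against an invariant measure -/

section Contractive

variable {X : Type*} [MetricSpace X] [MeasurableSpace X] [BorelSpace X]
  {ι : Type*} [Fintype ι]

/-- By invariance every transfer iterate of `f` has the same integral, while these iterates flatten
out pointwise under a uniform bound. Dominated convergence then recovers the integral from the orbit
of one point `x₀`, chosen independently of `μ`. -/
theorem tendsto_integral_of_isInvariantMeasure (P : ProbIFS X ι) (hP : P.IsAverageContractive)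
    {μ : Measure X} (hμ : P.IsInvariantMeasure μ) {f : X → ℂ} {K : ℝ≥0} (hf : LipschitzWith K f)
    {M : ℝ} (hM : ∀ x, ‖f x‖ ≤ M) (x₀ : X) :
    Tendsto (fun n => P.transfer^[n] f x₀) atTop (𝓝 (∫ x, f x ∂μ)) := by
  have := hμ.1
  have h1 : ∀ n, ∫ x, P.transfer^[n] f x ∂μ = ∫ x, f x ∂μ := fun n => by
    rw [← P.integral_markov_iterate n μ hf.continuous hM,
      Function.iterate_fixed (f := P.markov) hμ.2]
  have hint : ∀ n, Integrable (P.transfer^[n] f) μ := fun n =>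
    Integrable.of_bound (P.continuous_transfer_iterate hf.continuous n).measurable.aestronglyMeasurable
      M (Eventually.of_forall (P.norm_transfer_iterate_le hM n))
  have h2 : Tendsto (fun n => ∫ x, (P.transfer^[n] f x₀ - P.transfer^[n] f x) ∂μ) atTop
      (𝓝 (∫ _, (0 : ℂ) ∂μ)) := by
    refine tendsto_integral_of_dominated_convergence (fun _ => M + M)
      (fun n => ((integrable_const _).sub (hint n)).aestronglyMeasurable)
      (integrable_const _) (fun n => Eventually.of_forall fun x => ?_)
      (Eventually.of_forall fun x => P.tendsto_transfer_iterate_sub hP hf x₀ x)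
    refine (norm_sub_le _ _).trans ?_
    gcongr <;> exact P.norm_transfer_iterate_le hM n _
  have h3 : ∀ n, ∫ x, (P.transfer^[n] f x₀ - P.transfer^[n] f x) ∂μ =
      P.transfer^[n] f x₀ - ∫ x, f x ∂μ := fun n => by
    rw [integral_sub (integrable_const _) (hint n), h1]; simp
  simp only [h3, integral_zero] at h2
  simpa using h2.add_const (∫ x, f x ∂μ)

end Contractive

/-! ### Uniqueness and existence of invariant measures -/

section CharFun

open BoundedContinuousFunction

/-- Characters are bounded and Lipschitz, and their integrals determine a finite measure, so they
suffice as test functions. -/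
theorem lipschitzWith_innerProbChar {E : Type*}
    [NormedAddCommGroup E] [InnerProductSpace ℝ E] (t : E) : LipschitzWith ‖t‖₊ (innerProbChar t) := by
  refine LipschitzWith.of_dist_le_mul fun x y => ?_
  rw [innerProbChar_apply, innerProbChar_apply, dist_eq_norm]
  have h : ∀ a b : ℝ, ‖Complex.exp (a * Complex.I) - Complex.exp (b * Complex.I)‖ ≤ |a - b| := by
    intro a b
    have : Complex.exp (a * Complex.I) - Complex.exp (b * Complex.I) =
        Complex.exp (b * Complex.I) * (Complex.exp (Complex.I * ((a - b : ℝ) : ℂ)) - 1) := by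
      rw [mul_sub, ← Complex.exp_add]; push_cast; ring_nf
    rw [this, norm_mul, Complex.norm_exp_ofReal_mul_I, one_mul]
    exact Real.norm_exp_I_mul_ofReal_sub_one_le
  refine (h _ _).trans ?_
  rw [← inner_sub_left, mul_comm, dist_eq_norm]
  exact abs_real_inner_le_norm _ _

theorem norm_innerProbChar_le {E : Type*} [NormedAddCommGroup E]
    [InnerProductSpace ℝ E] (t x : E) : ‖innerProbChar t x‖ ≤ 1 := by
  rw [innerProbChar_apply, Complex.norm_exp_ofReal_mul_I]

variable {E : Type*} [NormedAddCommGroup E] [InnerProductSpace ℝ E] [CompleteSpace E]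
  [SecondCountableTopology E] [MeasurableSpace E] [BorelSpace E] {ι : Type*} [Fintype ι]

theorem isInvariantMeasure_unique (P : ProbIFS E ι) (hP : P.IsAverageContractive) {μ ν : Measure E}
    (hμ : P.IsInvariantMeasure μ) (hν : P.IsInvariantMeasure ν) : μ = ν := by
  have := hμ.1
  have := hν.1
  refine Measure.ext_of_charFun (funext fun t => ?_)
  rw [charFun_eq_integral_innerProbChar, charFun_eq_integral_innerProbChar]
  exact tendsto_nhds_unique
    (P.tendsto_integral_of_isInvariantMeasure hP hμ (lipschitzWith_innerProbChar t)
      (norm_innerProbChar_le t) 0)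
    (P.tendsto_integral_of_isInvariantMeasure hP hν (lipschitzWith_innerProbChar t)
      (norm_innerProbChar_le t) 0)

/-- The Markov iterates of a Dirac mass in `C` stay on `C`, hence have a weak limit point; average
contractivity makes that limit point itself invariant, without Cesàro averages. -/
theorem exists_isInvariantMeasure (P : ProbIFS E ι) (hP : P.IsAverageContractive) {C : Set E}
    (hC : IsCompact C) (hne : C.Nonempty) (hmaps : ∀ i, MapsTo (P.map i) C C) :
    ∃ μ : Measure E, P.IsInvariantMeasure μ ∧ μ Cᶜ = 0 := by
  obtain ⟨x₀, hx₀⟩ := hne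
  have hprob := P.isProbabilityMeasure_markov_iterate (Measure.dirac x₀)
  let m : ℕ → ProbabilityMeasure E := fun n => ⟨P.markov^[n] (Measure.dirac x₀), hprob n⟩
  have hm : ∀ n, P.markov^[n] (Measure.dirac x₀) Cᶜ = 0 := by
    intro n
    induction n with
    | zero =>
      rw [Function.iterate_zero, id, Measure.dirac_apply' _ hC.measurableSet.compl]
      simp [hx₀]
    | succ n ih =>
      rw [Function.iterate_succ_apply']
      exact P.markov_compl_eq_zero hC.measurableSet hmaps ih
  -- Tightness with a constant family: the one compact set `C` carries all the mass.
  have hcomp : IsCompact {μ : ProbabilityMeasure E | ∀ _ : ℕ, μ Cᶜ ≤ (0 : ℝ≥0)} :=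
    isCompact_setOfPred_probabilityMeasure_mass_eq_compl_isCompact_le (u := fun _ => 0)
      (K := fun _ => C) tendsto_const_nhds (fun _ => hC) (Or.inl inferInstance)
  have hmem : ∀ n, m n ∈ {μ : ProbabilityMeasure E | ∀ _ : ℕ, μ Cᶜ ≤ (0 : ℝ≥0)} := fun n _ => by
    refine le_of_eq ?_
    have : (((m n) Cᶜ : ℝ≥0) : ℝ≥0∞) = 0 := by
      rw [ProbabilityMeasure.ennreal_coeFn_eq_coeFn_toMeasure]; exact hm n
    exact_mod_cast this
  -- A nonprincipal ultrafilter replaces the extraction of a convergent subsequence.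
  obtain ⟨μ, hμC, hμ⟩ := hcomp.ultrafilter_le_nhds' ((hyperfilter ℕ).map m)
    (Filter.mem_map.2 (Filter.univ_mem' hmem))
  have hlim : Tendsto m (hyperfilter ℕ) (𝓝 μ) := hμ
  rw [ProbabilityMeasure.tendsto_iff_forall_integral_rclike_tendsto ℂ] at hlim
  have hle : (hyperfilter ℕ : Filter ℕ) ≤ atTop := Nat.hyperfilter_le_atTop
  have hdirac : ∀ (n : ℕ) (g : E → ℂ), Continuous g → (∀ x, ‖g x‖ ≤ 1) →
      ∫ x, g x ∂(m n : Measure E) = P.transfer^[n] g x₀ := fun n g hg hg1 => by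
    change ∫ x, g x ∂(P.markov^[n] (Measure.dirac x₀)) = _
    rw [P.integral_markov_iterate n _ hg hg1, integral_dirac]
  refine ⟨μ, ⟨inferInstance, ?_⟩, ?_⟩
  · have := P.isProbabilityMeasure_markov (μ : Measure E)
    refine Measure.ext_of_charFun (funext fun t => ?_)
    rw [charFun_eq_integral_innerProbChar, charFun_eq_integral_innerProbChar]
    set f : E →ᵇ ℂ := innerProbChar t
    have hf1 : ∀ x, ‖f x‖ ≤ 1 := norm_innerProbChar_le t
    rw [P.integral_markov _ f.continuous hf1]
    let g : E →ᵇ ℂ := BoundedContinuousFunction.ofNormedAddCommGroup (P.transfer f)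
      (P.continuous_transfer f.continuous) 1 (P.norm_transfer_le hf1)
    have hf := hlim f
    have hg := hlim g
    simp only [hdirac _ f f.continuous hf1, hdirac _ g g.continuous (P.norm_transfer_le hf1)]
      at hf hg
    -- Since `g` is the transfer of `f`, this difference averages the values of the `n`-th iterate
    -- at the points `P.map i x₀` minus its value at `x₀`.
    have hsub : Tendsto (fun n => P.transfer^[n] g x₀ - P.transfer^[n] f x₀) atTop (𝓝 0) := by
      have h1 : ∀ n, P.transfer^[n] g x₀ - P.transfer^[n] f x₀ =
          ∑ i, (P.prob i : ℝ) • (P.transfer^[n] f (P.map i x₀) - P.transfer^[n] f x₀) := by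
        intro n
        change P.transfer^[n] (P.transfer f) x₀ - _ = _
        rw [← Function.iterate_succ_apply, Function.iterate_succ_apply']
        simp only [smul_sub, Finset.sum_sub_distrib, ← Finset.sum_smul, P.sum_coe_prob, one_smul]
        rfl
      simp only [h1]
      have := tendsto_finsetSum (Finset.univ : Finset ι) fun i _ =>
        (P.tendsto_transfer_iterate_sub hP (lipschitzWith_innerProbChar t)
          (P.map i x₀) x₀).const_smul (P.prob i : ℝ)
      simpa using this
    have h0 := tendsto_nhds_unique (hg.sub hf) (hsub.mono_left hle)
    exact sub_eq_zero.1 h0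
  · rw [← ProbabilityMeasure.ennreal_coeFn_eq_coeFn_toMeasure]
    have := hμC 0
    simpa using this

theorem isInvariantMeasure_unique_of_iterate_two (P : ProbIFS E ι)
    (hP : (P.iterate 2).IsAverageContractive) {μ ν : Measure E}
    (hμ : P.IsInvariantMeasure μ) (hν : P.IsInvariantMeasure ν) : μ = ν :=
  (P.iterate 2).isInvariantMeasure_unique hP hμ.iterate_two hν.iterate_two

/-- The Markov operator commutes with its square, so it maps an invariant measure of the second
iterate to another one; uniqueness forces the two to coincide. -/
theorem exists_isInvariantMeasure_of_iterate_two (P : ProbIFS E ι)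
    (hP : (P.iterate 2).IsAverageContractive) {C : Set E}
    (hC : IsCompact C) (hne : C.Nonempty) (hmaps : ∀ i, MapsTo (P.map i) C C) :
    ∃ μ : Measure E, P.IsInvariantMeasure μ ∧ μ Cᶜ = 0 := by
  obtain ⟨μ, hμ, hμC⟩ := (P.iterate 2).exists_isInvariantMeasure hP hC hne fun w =>
    (hmaps (w 0)).comp (hmaps (Fin.tail w 0))
  have := hμ.1
  refine ⟨μ, ⟨hμ.1, ?_⟩, hμC⟩
  refine (P.iterate 2).isInvariantMeasure_unique hP ⟨P.isProbabilityMeasure_markov μ, ?_⟩ hμ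
  rw [markov_iterate_two, ← markov_iterate_two P μ, hμ.2]

end CharFun

/-- The support of an invariant measure is mapped into itself by every map of positive
probability. -/
theorem IsInvariantMeasure.mapsTo_support {X : Type*} [TopologicalSpace X] [MeasurableSpace X]
    [BorelSpace X] {ι : Type*} [Fintype ι] {P : ProbIFS X ι} {μ : Measure X}
    (hμ : P.IsInvariantMeasure μ) {i : ι} (hi : 0 < P.prob i) :
    MapsTo (P.map i) μ.support μ.support := by
  intro x hx
  rw [Measure.support_eq_forall_isOpen] at hx ⊢
  intro u hxu hu
  have h1 := hx (P.map i ⁻¹' u) hxu (hu.preimage (P.continuous_map i))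
  rw [← hμ.2]
  simp only [markov, Measure.coe_finsetSum, Finset.sum_apply, Measure.smul_apply]
  refine lt_of_lt_of_le ?_ (Finset.single_le_sum (fun _ _ => zero_le) (Finset.mem_univ i))
  rw [Measure.map_apply (P.continuous_map i).measurable hu.measurableSet, ENNReal.smul_def,
    smul_eq_mul]
  exact ENNReal.mul_pos (by exact_mod_cast hi.ne') h1.ne'

end ProbIFS

/-! ### Lower Kuratowski limits -/

theorem mem_lowerKuratowskiLimit_iff {X : Type*} [MetricSpace X] {S : ℕ → Set X} {y : X}
    (hS : ∀ n, (S n).Nonempty) :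
    y ∈ lowerKuratowskiLimit S ↔ Tendsto (fun n => Metric.infEDist y (S n)) atTop (𝓝 0) := by
  constructor
  · rintro ⟨x, hx, hlim⟩
    refine tendsto_of_tendsto_of_tendsto_of_le_of_le' tendsto_const_nhds
      (tendsto_iff_edist_tendsto_0.1 hlim) (Eventually.of_forall fun n => zero_le) ?_
    filter_upwards [eventually_ge_atTop 1] with n hn
    rw [edist_comm]
    exact Metric.infEDist_le_edist_of_mem (hx n hn)
  · intro h
    -- The infimum need not be attained, so a vanishing error is allowed.
    have hex : ∀ n, ∃ x ∈ S n, edist y x ≤ Metric.infEDist y (S n) + ((n : ℝ≥0∞) + 1)⁻¹ := by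
      intro n
      have hne : Metric.infEDist y (S n) ≠ ∞ := Metric.infEDist_ne_top (hS n)
      have hlt : Metric.infEDist y (S n) < Metric.infEDist y (S n) + ((n : ℝ≥0∞) + 1)⁻¹ :=
        ENNReal.lt_add_right hne (by simp)
      obtain ⟨x, hx, hxy⟩ := Metric.infEDist_lt_iff.1 hlt
      exact ⟨x, hx, hxy.le⟩
    choose x hx hxy using hex
    refine ⟨x, fun n _ => hx n, tendsto_iff_edist_tendsto_0.2 ?_⟩
    have h2 : Tendsto (fun n : ℕ => ((n : ℝ≥0∞) + 1)⁻¹) atTop (𝓝 0) := by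
      have := (tendsto_add_atTop_iff_nat 1).2 ENNReal.tendsto_inv_nat_nhds_zero
      simpa using this
    refine tendsto_of_tendsto_of_tendsto_of_le_of_le tendsto_const_nhds
      (by simpa using h.add h2) (fun n => zero_le) fun n => ?_
    change edist (x n) y ≤ _
    rw [edist_comm]
    exact hxy n

theorem isClosed_lowerKuratowskiLimit {X : Type*} [MetricSpace X] {S : ℕ → Set X}
    (hS : ∀ n, (S n).Nonempty) : IsClosed (lowerKuratowskiLimit S) := by
  refine isClosed_of_closure_subset fun y hy => ?_
  rw [mem_lowerKuratowskiLimit_iff hS, ENNReal.tendsto_nhds_zero]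
  intro ε hε
  obtain ⟨z, hz, hyz⟩ := EMetric.mem_closure_iff.1 hy (ε / 2) (ENNReal.half_pos hε.ne')
  rw [mem_lowerKuratowskiLimit_iff hS, ENNReal.tendsto_nhds_zero] at hz
  filter_upwards [hz (ε / 2) (ENNReal.half_pos hε.ne')] with n hn
  calc Metric.infEDist y (S n) ≤ Metric.infEDist z (S n) + edist y z :=
        Metric.infEDist_le_infEDist_add_edist
    _ ≤ ε / 2 + ε / 2 := add_le_add hn hyz.le
    _ = ε := ENNReal.add_halves ε

/-- Convergence in the Hausdorff metric from below to a compact set is pointwise. -/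
theorem tendsto_hausdorffEDist_of_subset_lowerKuratowskiLimit {X : Type*} [MetricSpace X]
    {S : ℕ → Set X} {K : Set X} (hK : IsCompact K) (hne : ∀ n, (S n).Nonempty)
    (hS : ∀ n, S n ⊆ K) (h : K ⊆ lowerKuratowskiLimit S) :
    Tendsto (fun n => Metric.hausdorffEDist (S n) K) atTop (𝓝 0) := by
  rw [ENNReal.tendsto_nhds_zero]
  intro ε hε
  have hε2 : 0 < ε / 2 := ENNReal.half_pos hε.ne'
  obtain ⟨t, htK, htfin, hcov⟩ := EMetric.totallyBounded_iff'.1 hK.totallyBounded (ε / 2) hε2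
  have hev : ∀ᶠ n in atTop, ∀ y ∈ t, Metric.infEDist y (S n) ≤ ε / 2 := by
    rw [eventually_all_finite htfin]
    intro y hy
    exact ENNReal.tendsto_nhds_zero.1 ((mem_lowerKuratowskiLimit_iff hne).1 (h (htK hy))) _ hε2
  filter_upwards [hev] with n hn
  refine Metric.hausdorffEDist_le_of_infEDist (fun x hx => ?_) fun x hx => ?_
  · rw [Metric.infEDist_zero_of_mem (hS n hx)]
    exact zero_le
  · obtain ⟨y, hy, hxy⟩ := mem_iUnion₂.1 (hcov hx)
    calc Metric.infEDist x (S n) ≤ Metric.infEDist y (S n) + edist x y :=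
          Metric.infEDist_le_infEDist_add_edist
      _ ≤ ε / 2 + ε / 2 := add_le_add (hn y hy) (le_of_lt hxy)
      _ = ε := ENNReal.add_halves ε

/-! ### Hutchinson iterates, words and fibres -/

namespace IFS

section Topological

variable {X : Type*} [TopologicalSpace X] {ι : Type*}

theorem image_subset_hutchinson (F : IFS X ι) (i : ι) (S : Set X) :
    F.map i '' S ⊆ F.hutchinson S :=
  (subset_iUnion (fun i => F.map i '' S) i).trans subset_closure

theorem hutchinson_mono (F : IFS X ι) {S T : Set X} (h : S ⊆ T) :
    F.hutchinson S ⊆ F.hutchinson T :=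
  closure_mono (iUnion_mono fun _ => image_mono h)

theorem hutchinson_iterate_mono (F : IFS X ι) {S T : Set X} (h : S ⊆ T) (n : ℕ) :
    F.hutchinson^[n] S ⊆ F.hutchinson^[n] T :=
  Monotone.iterate (f := F.hutchinson) (fun _ _ => F.hutchinson_mono) n h

theorem hutchinson_iterate_nonempty [Nonempty ι] (F : IFS X ι) {S : Set X} (h : S.Nonempty)
    (n : ℕ) : (F.hutchinson^[n] S).Nonempty := by
  induction n with
  | zero => exact h
  | succ n ih =>
    rw [Function.iterate_succ_apply']
    exact (ih.image _).mono (F.image_subset_hutchinson (Classical.arbitrary ι) _)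

theorem map_iterate_mem_hutchinson_iterate (F : IFS X ι) (i : ι) (x : X) (n : ℕ) :
    (F.map i)^[n] x ∈ F.hutchinson^[n] {x} := by
  induction n with
  | zero => rfl
  | succ n ih =>
    rw [Function.iterate_succ_apply', Function.iterate_succ_apply']
    exact F.image_subset_hutchinson i _ (mem_image_of_mem _ ih)

theorem IsInvariant.mapsTo {F : IFS X ι} {A : Set X} (h : F.IsInvariant A) (i : ι) :
    MapsTo (F.map i) A A := fun _ hx =>
  h.2.2 ▸ F.image_subset_hutchinson i A (mem_image_of_mem _ hx)

theorem wordMap_succ_last (F : IFS X ι) : ∀ (k : ℕ) (w : Fin (k + 1) → ι),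
    F.wordMap (k + 1) w = F.wordMap k (fun j => w j.castSucc) ∘ F.map (w (Fin.last k))
  | 0, w => rfl
  | k + 1, w => by
    change F.map (w 0) ∘ F.wordMap (k + 1) (Fin.tail w) = _
    rw [F.wordMap_succ_last k (Fin.tail w)]
    rfl

theorem wordMap_const (F : IFS X ι) (i : ι) :
    ∀ k : ℕ, F.wordMap k (fun _ => i) = (F.map i)^[k]
  | 0 => rfl
  | k + 1 => by
    rw [Function.iterate_succ', ← F.wordMap_const i k]
    rfl

theorem mapsTo_wordMap (F : IFS X ι) {A : Set X} (hA : ∀ i, MapsTo (F.map i) A A) :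
    ∀ (k : ℕ) (w : Fin k → ι), MapsTo (F.wordMap k w) A A
  | 0, _ => mapsTo_id A
  | k + 1, w => (hA (w 0)).comp (F.mapsTo_wordMap hA k (Fin.tail w))

theorem wordMap_image_antitone (F : IFS X ι) {A : Set X} (hA : ∀ i, MapsTo (F.map i) A A)
    (c : ℕ → ι) (n : ℕ) :
    F.wordMap (n + 1) (fun j => c j) '' A ⊆ F.wordMap n (fun j => c j) '' A := by
  rw [wordMap_succ_last, image_comp]
  exact image_mono (hA _).image_subset

theorem fibre_nonempty [T2Space X] (F : IFS X ι) {A : Set X} (hA : ∀ i, MapsTo (F.map i) A A)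
    (hc : IsCompact A) (hne : A.Nonempty) (c : ℕ → ι) : (F.fibre A c).Nonempty := by
  have hcomp : ∀ n, IsCompact (F.wordMap (n + 1) (fun j => c j) '' A) := fun n =>
    hc.image (F.continuous_wordMap _ _)
  exact IsCompact.nonempty_iInter_of_sequence_nonempty_isCompact_isClosed _
    (fun n => F.wordMap_image_antitone hA c (n + 1)) (fun n => hne.image _) (hcomp 0)
    fun n => (hcomp n).isClosed

theorem isCompact_fibre [T2Space X] (F : IFS X ι) {A : Set X} (hc : IsCompact A) (c : ℕ → ι) :
    IsCompact (F.fibre A c) :=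
  (hc.image (F.continuous_wordMap (0 + 1) fun j => c j)).of_isClosed_subset
    (isClosed_iInter fun _ => (hc.image (F.continuous_wordMap _ _)).isClosed) (iInter_subset _ 0)

/-- Injectivity lets the image commute with the intersection. Each term on the right is the next
term on the left; the first term on the left is discarded. -/
theorem fibre_cons_subset (F : IFS X ι) {A : Set X} {i : ι} (hi : Function.Injective (F.map i))
    (c : ℕ → ι) :
    F.fibre A (fun n => Nat.casesOn n i c) ⊆ F.map i '' F.fibre A c := by
  rw [fibre, fibre, InjOn.image_iInter_eq hi.injOn]
  refine subset_iInter fun n => (iInter_subset _ (n + 1)).trans (le_of_eq ?_)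
  rw [← image_comp]
  rfl

end Topological

section Metric

variable {X : Type*} [MetricSpace X] {ι : Type*}

theorem map_mem_lowerKuratowskiLimit (F : IFS X ι) (i : ι) {S : Set X} {y : X}
    (hy : y ∈ lowerKuratowskiLimit fun n => F.hutchinson^[n] S) (hS : S.Nonempty) :
    F.map i y ∈ lowerKuratowskiLimit fun n => F.hutchinson^[n] S := by
  have : Nonempty ι := ⟨i⟩
  obtain ⟨x, hx, hlim⟩ := hy
  rw [mem_lowerKuratowskiLimit_iff fun n => F.hutchinson_iterate_nonempty hS n,
    ← tendsto_add_atTop_iff_nat 1]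
  have h1 : Tendsto (fun n => edist (F.map i y) (F.map i (x n))) atTop (𝓝 0) := by
    have := tendsto_iff_edist_tendsto_0.1 (((F.continuous_map i).tendsto y).comp hlim)
    simpa only [edist_comm, Function.comp_def] using this
  refine tendsto_of_tendsto_of_tendsto_of_le_of_le' tendsto_const_nhds h1
    (Eventually.of_forall fun n => zero_le) ?_
  filter_upwards [eventually_ge_atTop 1] with n hn
  refine Metric.infEDist_le_edist_of_mem ?_
  rw [Function.iterate_succ_apply']
  exact F.image_subset_hutchinson i _ (mem_image_of_mem _ (hx n hn))

/-- If `A` has no proper nonempty closed subset mapped into itself and one of the maps has a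
globally attracting fixed point in `A`, then the iterates of every point accumulate on `A`. -/
theorem subset_lowerKuratowskiLimit (F : IFS X ι) {A : Set X} (hA : IsClosed A)
    (hmaps : ∀ i, MapsTo (F.map i) A A)
    (hmin : ∀ C ⊆ A, IsClosed C → C.Nonempty → (∀ i, MapsTo (F.map i) C C) → C = A)
    {z : X} (hz : z ∈ A) {j : ι} {x : X}
    (hx : Tendsto (fun n => (F.map j)^[n] x) atTop (𝓝 z)) :
    A ⊆ lowerKuratowskiLimit fun n => F.hutchinson^[n] {x} := by
  have : Nonempty ι := ⟨j⟩
  rw [← inter_eq_left]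
  refine hmin _ inter_subset_left (hA.inter (isClosed_lowerKuratowskiLimit fun n =>
    F.hutchinson_iterate_nonempty (singleton_nonempty x) n)) ⟨z, hz, _, fun n _ =>
    F.map_iterate_mem_hutchinson_iterate j x n, hx⟩ fun i y hy => ⟨hmaps i hy.1, ?_⟩
  exact F.map_mem_lowerKuratowskiLimit i hy.2 (singleton_nonempty x)

theorem lowerKuratowskiLimit_subset {S : ℕ → Set X} {A : Set X} (hA : IsClosed A)
    (h : ∀ n, S n ⊆ A) : lowerKuratowskiLimit S ⊆ A := by
  rintro y ⟨x, hx, hlim⟩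
  refine hA.mem_of_tendsto hlim ?_
  filter_upwards [eventually_ge_atTop 1] with n hn
  exact h n (hx n hn)

theorem hutchinson_iterate_subset (F : IFS X ι) {A S : Set X} (hA : IsClosed A)
    (hmaps : ∀ i, MapsTo (F.map i) A A) (hS : S ⊆ A) (n : ℕ) : F.hutchinson^[n] S ⊆ A := by
  induction n with
  | zero => exact hS
  | succ n ih =>
    rw [Function.iterate_succ_apply']
    exact closure_minimal (iUnion_subset fun i => ((hmaps i).mono_left ih).image_subset) hA

end Metric

end IFS

/-! ### The Barnsley–Vince maps and the triangle -/

namespace BarnsleyVince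

/-- The Euclidean plane. -/
abbrev Plane := EuclideanSpace ℝ (Fin 2)

@[simp] theorem ifs_zero_apply_zero (v : Plane) : ifs.map 0 v 0 = v 0 + v 1 / 2 := by
  simp [ifs, mat]; ring

@[simp] theorem ifs_zero_apply_one (v : Plane) : ifs.map 0 v 1 = v 1 / 2 := by
  simp [ifs, mat]; ring

@[simp] theorem ifs_one_apply_zero (v : Plane) : ifs.map 1 v 0 = v 1 / 2 := by
  simp [ifs, mat]; ring

@[simp] theorem ifs_one_apply_one (v : Plane) : ifs.map 1 v 1 = 1 - v 0 - v 1 / 2 := by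
  simp [ifs, mat]; ring

theorem ext_coord {v w : Plane} (h0 : v 0 = w 0) (h1 : v 1 = w 1) : v = w := by
  ext i; fin_cases i
  exacts [h0, h1]

theorem injective_map (i : Fin 2) : Function.Injective (ifs.map i) := by
  intro v w h
  have h0 := congrArg (fun u : Plane => u 0) h
  have h1 := congrArg (fun u : Plane => u 1) h
  fin_cases i
  · simp at h0 h1
    exact ext_coord (by linarith) (by linarith)
  · simp at h0 h1
    exact ext_coord (by linarith) (by linarith)

theorem mem_triangle {v : Plane} : v ∈ triangle ↔ 0 ≤ v 0 ∧ 0 ≤ v 1 ∧ v 0 + v 1 ≤ 1 := by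
  constructor
  · intro h
    have hconv : Convex ℝ {v : Plane | 0 ≤ v 0 ∧ 0 ≤ v 1 ∧ v 0 + v 1 ≤ 1} := by
      rintro v ⟨h0, h1, h2⟩ w ⟨k0, k1, k2⟩ a b ha hb hab
      simp only [mem_ofPred_eq, PiLp.add_apply, PiLp.smul_apply, smul_eq_mul]
      refine ⟨by positivity, by positivity, ?_⟩
      nlinarith
    refine convexHull_min ?_ hconv h
    rintro w (rfl | rfl | rfl) <;> simp
  · rintro ⟨h0, h1, h2⟩
    have hc := convex_convexHull ℝ ({!₂[0, 0], !₂[1, 0], !₂[0, 1]} : Set Plane)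
    have e0 : (!₂[0, 0] : Plane) ∈ triangle := subset_convexHull _ _ (by simp)
    have e1 : (!₂[1, 0] : Plane) ∈ triangle := subset_convexHull _ _ (by simp)
    have e2 : (!₂[0, 1] : Plane) ∈ triangle := subset_convexHull _ _ (by simp)
    have key := hc.sum_mem (t := Finset.univ) (w := ![1 - v 0 - v 1, v 0, v 1])
      (z := ![!₂[0, 0], !₂[1, 0], !₂[0, 1]]) (by
        intro i _; fin_cases i
        · simp; linarith
        · simpa using h0
        · simpa using h1) (by simp [Fin.sum_univ_three]; ring) (by
        intro i _; fin_cases i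
        exacts [e0, e1, e2])
    have hv : v = ∑ i, ![1 - v 0 - v 1, v 0, v 1] i •
        (![!₂[0, 0], !₂[1, 0], !₂[0, 1]] : Fin 3 → Plane) i := by
      refine ext_coord ?_ ?_ <;> simp [Fin.sum_univ_three]
    exact hv ▸ key

theorem isCompact_triangle : IsCompact triangle :=
  (Set.toFinite _).isCompact_convexHull ℝ

theorem convex_triangle : Convex ℝ triangle := convex_convexHull ℝ _

theorem mapsTo_triangle (i : Fin 2) : MapsTo (ifs.map i) triangle triangle := by
  intro v hv
  rw [mem_triangle] at hv ⊢
  obtain ⟨h0, h1, h2⟩ := hv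
  fin_cases i
  · simp; refine ⟨?_, ?_, ?_⟩ <;> linarith
  · simp; refine ⟨?_, ?_, ?_⟩ <;> linarith

/-- The line `v 0 = v 1` cuts the triangle into the images of the two maps; this tiling yields
invariance both of the set and of Lebesgue measure. The witnesses come from inverting the map. -/
theorem map_zero_image_triangle :
    ifs.map 0 '' triangle = {v | v ∈ triangle ∧ v 1 ≤ v 0} := by
  ext v
  constructor
  · rintro ⟨u, hu, rfl⟩
    refine ⟨mapsTo_triangle 0 hu, ?_⟩
    rw [mem_triangle] at hu
    simp; linarith
  · rintro ⟨h, h'⟩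
    rw [mem_triangle] at h
    refine ⟨!₂[v 0 - v 1, 2 * v 1], mem_triangle.2 ?_, ext_coord ?_ ?_⟩ <;> simp
    refine ⟨?_, ?_, ?_⟩ <;> linarith

theorem map_one_image_triangle :
    ifs.map 1 '' triangle = {v | v ∈ triangle ∧ v 0 ≤ v 1} := by
  ext v
  constructor
  · rintro ⟨u, hu, rfl⟩
    refine ⟨mapsTo_triangle 1 hu, ?_⟩
    rw [mem_triangle] at hu
    simp; linarith
  · rintro ⟨h, h'⟩
    rw [mem_triangle] at h
    refine ⟨!₂[1 - v 1 - v 0, 2 * v 0], mem_triangle.2 ?_, ext_coord ?_ ?_⟩ <;> simp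
    · refine ⟨?_, ?_, ?_⟩ <;> linarith
    · ring

theorem isInvariant_triangle : ifs.IsInvariant triangle := by
  refine ⟨⟨!₂[0, 0], mem_triangle.2 (by simp)⟩, isCompact_triangle.isClosed, ?_⟩
  have h : ⋃ i, ifs.map i '' triangle = triangle := by
    ext v
    simp only [mem_iUnion, Fin.exists_fin_two, map_zero_image_triangle, map_one_image_triangle,
      mem_ofPred_eq]
    have := le_total (v 1) (v 0)
    tauto
  rw [IFS.hutchinson, h, isCompact_triangle.isClosed.closure_eq]

/-! ### Lipschitz constants and contractivity on average -/

theorem edist_le_of_sq_le {x y u v : Plane} {K : ℝ} (hK : 0 ≤ K)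
    (h : (x 0 - y 0) ^ 2 + (x 1 - y 1) ^ 2 ≤ K ^ 2 * ((u 0 - v 0) ^ 2 + (u 1 - v 1) ^ 2)) :
    edist x y ≤ ENNReal.ofReal K * edist u v := by
  rw [edist_dist, edist_dist, ← ENNReal.ofReal_mul hK]
  refine ENNReal.ofReal_le_ofReal ?_
  rw [EuclideanSpace.dist_eq, EuclideanSpace.dist_eq]
  simp only [Fin.sum_univ_two, Real.dist_eq, sq_abs]
  refine Real.sqrt_le_iff.2 ⟨by positivity, ?_⟩
  rwa [mul_pow, Real.sq_sqrt (by positivity)]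

/-- The Lipschitz constants of `f_i ∘ f_j`, which only depend on `j`. -/
noncomputable def lipBound : Fin 2 → ℝ := ![√(3 * √17 + 13) / 4, √2 / 2]

theorem lipBound_nonneg (j : Fin 2) : 0 ≤ lipBound j := by
  fin_cases j
  · change 0 ≤ √(3 * √17 + 13) / 4
    positivity
  · change 0 ≤ √2 / 2
    positivity

theorem lipConst_comp_le (i j : Fin 2) :
    lipConst (ifs.map i ∘ ifs.map j) ≤ ENNReal.ofReal (lipBound j) := by
  refine lipConst_le fun x y => edist_le_of_sq_le (lipBound_nonneg j) ?_
  have h17 : √17 ^ 2 = 17 := Real.sq_sqrt (by norm_num)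
  have h17' : (1 : ℝ) < √17 := by rw [Real.lt_sqrt] <;> norm_num
  have hs : (√2 / 2) ^ 2 = 1 / 2 := by rw [div_pow, Real.sq_sqrt] <;> norm_num
  have hL : (√(3 * √17 + 13) / 4) ^ 2 = (3 * √17 + 13) / 16 := by
    rw [div_pow, Real.sq_sqrt (by positivity)]; norm_num
  -- The squared norm of `A₁A₁`, and equally of `A₂A₁`, applied to `(a, b)`. Its largest eigenvalue
  -- is `(3√17 + 13) / 16`; multiplying the defect by that eigenvalue minus one completes the
  -- square. The other two products give `a²/2 + b²/8`.
  have hform : ∀ a b : ℝ, (a + 3 / 4 * b) ^ 2 + (b / 4) ^ 2 ≤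
      (3 * √17 + 13) / 16 * (a ^ 2 + b ^ 2) := by
    intro a b
    have hpos : 0 < 3 * (√17 - 1) / 16 := by linarith
    have hid : 3 * (√17 - 1) / 16 * ((3 * √17 + 13) / 16 * (a ^ 2 + b ^ 2) -
        ((a + 3 / 4 * b) ^ 2 + (b / 4) ^ 2)) = (3 * (√17 - 1) / 16 * a - 3 / 4 * b) ^ 2 := by
      linear_combination (9 / 256 * b ^ 2) * h17
    have := nonneg_of_mul_nonneg_right (hid.symm ▸ sq_nonneg _) hpos
    linarith
  fin_cases i <;> fin_cases j <;> simp [lipBound, hs, hL]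
  · have := hform (x 0 - y 0) (x 1 - y 1)
    nlinarith
  · nlinarith
  · have := hform (x 0 - y 0) (x 1 - y 1)
    nlinarith
  · nlinarith

theorem isAverageContractive_iterate_two (p : Fin 2 → ℝ≥0) (hp : ∑ i, p i = 1)
    (h : p 0 * lipBound 0 + p 1 * lipBound 1 < 1) :
    ((probIFS p hp).iterate 2).IsAverageContractive := by
  have hp' : (p 0 : ℝ) + p 1 = 1 := by
    rw [Fin.sum_univ_two] at hp; exact_mod_cast hp
  have h1 : ∑ w : Fin 2 → Fin 2, (((probIFS p hp).iterate 2).prob w : ℝ≥0∞) *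
      lipConst (((probIFS p hp).iterate 2).map w) =
      ∑ i, ∑ j, ((p i * p j : ℝ≥0) : ℝ≥0∞) * lipConst (ifs.map i ∘ ifs.map j) := by
    rw [← Fintype.sum_prod_type']
    refine Fintype.sum_equiv (finTwoArrowEquiv (Fin 2)) _ _ fun w => ?_
    simp [ProbIFS.iterate, IFS.wordMap, Fin.tail, Fin.prod_univ_two, finTwoArrowEquiv, probIFS]
  have h2 : ∀ i j, ((p i * p j : ℝ≥0) : ℝ≥0∞) * lipConst (ifs.map i ∘ ifs.map j) ≤
      ENNReal.ofReal (p i * p j * lipBound j) := fun i j => by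
    rw [ENNReal.ofReal_mul (by positivity), ← NNReal.coe_mul, ENNReal.ofReal_coe_nnreal]
    gcongr
    exact lipConst_comp_le i j
  unfold ProbIFS.IsAverageContractive
  rw [h1]
  refine (Finset.sum_le_sum fun i _ => Finset.sum_le_sum fun j _ => h2 i j).trans_lt ?_
  have h3 : ∀ i j, 0 ≤ (p i : ℝ) * p j * lipBound j := fun i j =>
    mul_nonneg (by positivity) (lipBound_nonneg j)
  simp_rw [← ENNReal.ofReal_sum_of_nonneg fun j _ => h3 _ j]
  rw [← ENNReal.ofReal_sum_of_nonneg fun i _ => Finset.sum_nonneg fun j _ => h3 i j,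
    ← ENNReal.ofReal_one, ENNReal.ofReal_lt_ofReal_iff one_pos]
  simp only [Fin.sum_univ_two]
  -- The double sum factors because the bound depends on the inner map only.
  calc _ = ((p 0 : ℝ) + p 1) * (p 0 * lipBound 0 + p 1 * lipBound 1) := by ring
    _ < 1 := by rw [hp', one_mul]; exact h

/-- The upper bound settles equal probabilities, as `(1.27 + 0.72) / 2 < 1`. The lower one makes the
denominator of the threshold positive and excludes `p 0 = 1`. -/
theorem lipBound_zero_bounds : 1 < lipBound 0 ∧ lipBound 0 < 1.27 := by
  have h1 : (4 : ℝ) < √17 := by rw [Real.lt_sqrt] <;> norm_num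
  have h2 : √17 < 4.15 := by rw [Real.sqrt_lt'] <;> norm_num
  simp only [lipBound, Matrix.cons_val_zero]
  constructor
  · rw [lt_div_iff₀ (by norm_num), Real.lt_sqrt (by norm_num)]; linarith
  · rw [div_lt_iff₀ (by norm_num), Real.sqrt_lt' (by norm_num)]; linarith

theorem lipBound_one_lt : lipBound 1 < 0.72 := by
  have h2 : √2 < 1.42 := by rw [Real.sqrt_lt'] <;> norm_num
  simp only [lipBound, Matrix.cons_val_one, Matrix.cons_val_fin_one]
  linarith

theorem lt_threshold_iff (x : ℝ) :
    x < (4 - 2 * √2) / (√(3 * √17 + 13) - 2 * √2) ↔ x * lipBound 0 + (1 - x) * lipBound 1 < 1 := by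
  have h0 := lipBound_zero_bounds.1
  have h1 := lipBound_one_lt
  simp only [lipBound, Matrix.cons_val_zero, Matrix.cons_val_one, Matrix.cons_val_fin_one]
    at h0 h1 ⊢
  rw [lt_div_iff₀ (by linarith)]
  constructor <;> intro h <;> linarith

/-! ### Lebesgue measure on the triangle -/

theorem nonempty_interior_triangle : (interior triangle).Nonempty := by
  refine ⟨!₂[1 / 4, 1 / 4], mem_interior.2 ⟨{v | 0 < v 0 ∧ 0 < v 1 ∧ v 0 + v 1 < 1}, ?_, ?_, ?_⟩⟩
  · rintro v ⟨h0, h1, h2⟩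
    exact mem_triangle.2 ⟨h0.le, h1.le, h2.le⟩
  · have h0 : Continuous fun v : Plane => v 0 := by fun_prop
    have h1 : Continuous fun v : Plane => v 1 := by fun_prop
    exact (isOpen_lt continuous_const h0).inter
      ((isOpen_lt continuous_const h1).inter (isOpen_lt (h0.add h1) continuous_const))
  · simp only [mem_ofPred_eq]; norm_num

theorem volume_triangle_ne_zero : volume triangle ≠ 0 :=
  (Measure.measure_pos_of_nonempty_interior _ nonempty_interior_triangle).ne'

theorem volume_triangle_ne_top : volume triangle ≠ ∞ := isCompact_triangle.measure_ne_top

theorem isProbabilityMeasure_lebesgueTriangle : IsProbabilityMeasure lebesgueTriangle := by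
  constructor
  rw [lebesgueTriangle, Measure.smul_apply, Measure.restrict_apply_univ, smul_eq_mul,
    ENNReal.inv_mul_cancel volume_triangle_ne_zero volume_triangle_ne_top]

theorem lebesgueTriangle_compl : lebesgueTriangle triangleᶜ = 0 := by
  rw [lebesgueTriangle, Measure.smul_apply,
    Measure.restrict_apply isCompact_triangle.measurableSet.compl]
  simp

/-- A convex set with interior points lies in the closure of its interior, so a missing point would
leave a nonempty open piece of positive area outside `C`. -/
theorem eq_triangle_of_lebesgueTriangle_compl {C : Set Plane} (hC : IsClosed C) (hsub : C ⊆ triangle)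
    (h : lebesgueTriangle Cᶜ = 0) : C = triangle := by
  refine hsub.antisymm fun a ha => by_contra fun haC => ?_
  have hcl : a ∈ closure (interior triangle) := by
    rw [convex_triangle.closure_interior_eq_closure_of_nonempty_interior
      nonempty_interior_triangle]
    exact subset_closure ha
  have hne := mem_closure_iff.1 hcl Cᶜ hC.isOpen_compl haC
  have hpos := (hC.isOpen_compl.inter isOpen_interior).measure_pos volume hne
  rw [lebesgueTriangle, Measure.smul_apply, Measure.restrict_apply hC.measurableSet.compl,
    smul_eq_mul, mul_eq_zero, ENNReal.inv_eq_zero] at h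
  refine h.elim volume_triangle_ne_top fun h0 => hpos.ne' (measure_mono_null ?_ h0)
  exact inter_subset_inter_right _ interior_subset

theorem volume_image (i : Fin 2) (S : Set Plane) :
    volume (ifs.map i '' S) = ENNReal.ofReal (1 / 2) * volume S := by
  have h : ifs.map i '' S = (fun v => !₂[0, ((i : ℕ) : ℝ)] + v) ''
      (Matrix.toEuclideanLin (mat i) '' S) := by
    rw [← image_comp]
    refine image_congr fun v _ => ?_
    refine (add_comm _ _).trans ?_
    simp [Matrix.toLpLin_apply]
  have hdet : LinearMap.det (Matrix.toEuclideanLin (mat i)) = 1 / 2 := by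
    rw [Matrix.toEuclideanLin_eq_toLin_orthonormal, LinearMap.det_toLin]
    fin_cases i <;> simp [mat, Matrix.det_fin_two]
  rw [h, image_add_left, measure_preimage_add, Measure.addHaar_image_linearMap, hdet]
  norm_num

theorem volume_diagonal : volume {v : Plane | v 0 = v 1} = 0 := by
  let s : Submodule ℝ Plane := LinearMap.ker
    ((EuclideanSpace.proj 0 : Plane →L[ℝ] ℝ) - EuclideanSpace.proj 1 : Plane →L[ℝ] ℝ).toLinearMap
  have hs : {v : Plane | v 0 = v 1} = s := by
    ext v
    simp [s, sub_eq_zero]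
  rw [hs]
  refine Measure.addHaar_submodule _ _ fun htop => ?_
  have : (!₂[1, 0] : Plane) ∈ s := htop ▸ Submodule.mem_top
  rw [← SetLike.mem_coe, ← hs] at this
  simp at this

theorem isInvariantMeasure_lebesgueTriangle (p : Fin 2 → ℝ≥0) (hp : ∑ i, p i = 1)
    (h0 : p 0 = 1 / 2) (h1 : p 1 = 1 / 2) :
    (probIFS p hp).IsInvariantMeasure lebesgueTriangle := by
  refine ⟨isProbabilityMeasure_lebesgueTriangle, ?_⟩
  have hmeas : ∀ i, Measurable (ifs.map i) := fun i => (ifs.continuous_map i).measurable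
  -- Both linear parts have determinant `1/2`, which matches the probability.
  have key : ∀ (i : Fin 2) (B : Set Plane), (1 / 2 : ℝ≥0∞) * volume (ifs.map i ⁻¹' B ∩ triangle) =
      volume (B ∩ ifs.map i '' triangle) := fun i B => by
    rw [inter_comm B, ← image_inter_preimage, volume_image, inter_comm triangle]
    congr 1
    rw [ENNReal.ofReal_div_of_pos two_pos]; simp
  ext B hB
  have hmap : ∀ i, (lebesgueTriangle.map (ifs.map i)) B =
      (volume triangle)⁻¹ * volume (ifs.map i ⁻¹' B ∩ triangle) := fun i => by
    rw [Measure.map_apply (hmeas i) hB, lebesgueTriangle, Measure.smul_apply,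
      Measure.restrict_apply (hmeas i hB), smul_eq_mul]
  have hhalf : ((1 / 2 : ℝ≥0) : ℝ≥0∞) = 1 / 2 := by simp
  have hunion : volume (B ∩ triangle) =
      volume (B ∩ ifs.map 0 '' triangle) + volume (B ∩ ifs.map 1 '' triangle) := by
    rw [← measure_union₀ (hB.inter ((isCompact_triangle.image
      (ifs.continuous_map 1)).measurableSet)).nullMeasurableSet, ← inter_union_distrib_left]
    · congr 2
      ext v
      simp only [map_zero_image_triangle, map_one_image_triangle, mem_union, mem_ofPred_eq]
      have := le_total (v 1) (v 0)
      tauto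
    · refine measure_mono_null ?_ volume_diagonal
      rintro v ⟨⟨_, hv⟩, ⟨_, hw⟩⟩
      rw [map_zero_image_triangle] at hv
      rw [map_one_image_triangle] at hw
      exact le_antisymm hw.2 hv.2
  simp only [ProbIFS.markov, Fin.sum_univ_two, Measure.add_apply, Measure.smul_apply]
  change p 0 • (lebesgueTriangle.map (ifs.map 0)) B + p 1 • (lebesgueTriangle.map (ifs.map 1)) B = _
  rw [hmap, hmap, h0, h1, ENNReal.smul_def, ENNReal.smul_def, smul_eq_mul, smul_eq_mul, hhalf,
    mul_left_comm, key, mul_left_comm, key, ← mul_add, ← hunion, lebesgueTriangle,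
    Measure.smul_apply, Measure.restrict_apply hB, smul_eq_mul]

theorem isAverageContractive_half (p : Fin 2 → ℝ≥0) (hp : ∑ i, p i = 1)
    (h0 : p 0 = 1 / 2) (h1 : p 1 = 1 / 2) : ((probIFS p hp).iterate 2).IsAverageContractive := by
  refine isAverageContractive_iterate_two p hp ?_
  rw [h0, h1]
  have := lipBound_zero_bounds.2
  have := lipBound_one_lt
  push_cast
  linarith

/-- The triangle has no proper nonempty closed subset which is mapped into itself. -/
theorem eq_triangle_of_mapsTo {C : Set Plane} (hsub : C ⊆ triangle) (hC : IsClosed C)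
    (hne : C.Nonempty) (hmaps : ∀ i, MapsTo (ifs.map i) C C) : C = triangle := by
  -- The statement involves no probabilities; these are chosen so that the unique invariant measure
  -- is Lebesgue measure.
  let p : Fin 2 → ℝ≥0 := fun _ => 1 / 2
  have hp : ∑ i, p i = 1 := by simp [p]
  have hcontr := isAverageContractive_half p hp rfl rfl
  obtain ⟨μ, hμ, hμC⟩ := (probIFS p hp).exists_isInvariantMeasure_of_iterate_two hcontr
    (isCompact_triangle.of_isClosed_subset hC hsub) hne hmaps
  rw [(probIFS p hp).isInvariantMeasure_unique_of_iterate_two hcontr hμ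
    (isInvariantMeasure_lebesgueTriangle p hp rfl rfl)] at hμC
  exact eq_triangle_of_lebesgueTriangle_compl hC hsub hμC

/-- An invariant measure concentrated on the triangle, for positive probabilities, is supported
on the whole triangle. -/
theorem support_eq_triangle (p : Fin 2 → ℝ≥0) (hp : ∑ i, p i = 1) (hpos : ∀ i, 0 < p i)
    {μ : Measure Plane} (hμ : (probIFS p hp).IsInvariantMeasure μ) (h : μ triangleᶜ = 0) :
    μ.support = triangle := by
  have := hμ.1
  refine eq_triangle_of_mapsTo
    (Measure.support_subset_of_isClosed isCompact_triangle.isClosed (mem_ae_iff.2 h)) Measure.isClosed_support (Measure.nonempty_support ?_)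
    fun i => hμ.mapsTo_support (hpos i)
  exact IsProbabilityMeasure.ne_zero μ

theorem dist_sq_eq (x y : Plane) : dist x y ^ 2 = (x 0 - y 0) ^ 2 + (x 1 - y 1) ^ 2 := by
  rw [EuclideanSpace.dist_eq, Real.sq_sqrt (by positivity)]
  simp only [Fin.sum_univ_two, Real.dist_eq, sq_abs]

/-! ### The attracting fixed point of the second map -/

/-- The fixed point of the second map. -/
noncomputable def fixedPt : Plane := !₂[1 / 4, 1 / 2]

theorem fixedPt_mem : fixedPt ∈ triangle := mem_triangle.2 (by simp [fixedPt]; norm_num)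

/-- A quadratic form centred at the fixed point of the second map, which that map halves. -/
noncomputable def quad (v : Plane) : ℝ :=
  2 * (v 0 - 1 / 4) ^ 2 + (v 0 - 1 / 4) * (v 1 - 1 / 2) + (v 1 - 1 / 2) ^ 2

/-- The linear part has trace `-1/2` and determinant `1/2`, hence conjugate complex eigenvalues of
modulus `1/√2`; it is a similarity for a suitable elliptic norm, though not a Euclidean contraction.
-/
theorem quad_map_one_iterate (n : ℕ) (v : Plane) :
    quad ((ifs.map 1)^[n] v) = (1 / 2) ^ n * quad v := by
  induction n with
  | zero => simp
  | succ n ih =>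
    rw [Function.iterate_succ_apply', pow_succ', mul_assoc, ← ih]
    simp only [quad, ifs_one_apply_zero, ifs_one_apply_one]
    ring

theorem dist_fixedPt_sq_le (v : Plane) : dist v fixedPt ^ 2 ≤ 2 * quad v := by
  rw [dist_sq_eq]
  simp only [fixedPt, quad, PiLp.toLp_apply, Matrix.cons_val_zero, Matrix.cons_val_one,
    Matrix.cons_val_fin_one]
  nlinarith [sq_nonneg (v 0 - 1 / 4 + (v 1 - 1 / 2)), sq_nonneg (v 0 - 1 / 4)]

theorem tendsto_map_one_iterate (x : Plane) :
    Tendsto (fun n => (ifs.map 1)^[n] x) atTop (𝓝 fixedPt) := by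
  rw [tendsto_iff_dist_tendsto_zero]
  have h1 : Tendsto (fun n : ℕ => √(2 * ((1 / 2 : ℝ) ^ n * quad x))) atTop (𝓝 0) := by
    have h := (tendsto_pow_atTop_nhds_zero_of_lt_one (r := (1 / 2 : ℝ)) (by norm_num)
      (by norm_num)).mul_const (quad x) |>.const_mul 2 |>.sqrt
    simpa using h
  refine squeeze_zero (fun _ => dist_nonneg) (fun n => ?_) h1
  rw [← quad_map_one_iterate]
  exact Real.le_sqrt_of_sq_le (dist_fixedPt_sq_le _)

theorem fibre_one_subset : ifs.fibre triangle (fun _ => 1) ⊆ {fixedPt} := by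
  intro p hp
  have hle : ∀ n : ℕ, dist p fixedPt ^ 2 ≤ 10 * (1 / 2) ^ n := by
    intro n
    obtain ⟨q, hq, rfl⟩ := ifs.wordMap_image_antitone mapsTo_triangle (fun _ => 1) n
      (mem_iInter.1 hp n)
    rw [IFS.wordMap_const]
    refine (dist_fixedPt_sq_le _).trans ?_
    rw [quad_map_one_iterate]
    have hq4 : quad q ≤ 5 := by
      obtain ⟨h0, h1, h2⟩ := mem_triangle.1 hq
      unfold quad
      nlinarith
    have : (0 : ℝ) ≤ (1 / 2) ^ n := by positivity
    nlinarith
  have hlim : Tendsto (fun n : ℕ => 10 * (1 / 2 : ℝ) ^ n) atTop (𝓝 0) := by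
    simpa using (tendsto_pow_atTop_nhds_zero_of_lt_one (r := (1 / 2 : ℝ)) (by norm_num)
      (by norm_num)).const_mul 10
  have h0 := ge_of_tendsto' hlim hle
  exact dist_eq_zero.1 (pow_eq_zero_iff two_ne_zero |>.1 (le_antisymm h0 (sq_nonneg _)))

theorem isStronglyFibred_triangle : ifs.IsStronglyFibred triangle := by
  -- These points form a closed set, stable under the maps by prefixing a letter to the address, and
  -- containing the fixed point, whose constant address has a one-point fibre.
  let C : Set Plane := {a | a ∈ triangle ∧
    ∀ V : Set Plane, IsOpen V → a ∈ V → ∃ c, ifs.fibre triangle c ⊆ V}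
  have hC : C = triangle := by
    refine eq_triangle_of_mapsTo (fun a ha => ha.1) (isClosed_of_closure_subset fun a ha => ?_)
      ⟨fixedPt, fixedPt_mem, fun V _ hV => ⟨fun _ => 1, fibre_one_subset.trans (by simpa)⟩⟩
      fun i a ha => ⟨mapsTo_triangle i ha.1, fun V hV haV => ?_⟩
    · refine ⟨closure_minimal (fun a ha => ha.1) isCompact_triangle.isClosed ha, fun V hV haV => ?_⟩
      obtain ⟨b, hbV, hb⟩ := mem_closure_iff.1 ha V hV haV
      exact hb.2 V hV hbV
    · obtain ⟨c, hc⟩ := ha.2 _ (hV.preimage (ifs.continuous_map i)) haV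
      exact ⟨_, (ifs.fibre_cons_subset (injective_map i) c).trans (image_subset_iff.2 hc)⟩
  intro a ha
  rw [← hC] at ha
  exact ha.2

/-- The first map fixes both `(0,0)` and `(1,0)`, so they share the fibre of its constant address.
-/
theorem not_isPointFibred_triangle : ¬ ifs.IsPointFibred triangle := by
  intro h
  obtain ⟨a, ha⟩ := h fun _ => 0
  have hmem : ∀ p ∈ triangle, ifs.map 0 p = p → p = a := by
    intro p hp hfix
    rw [← mem_singleton_iff, ← ha]
    refine mem_iInter.2 fun n => ⟨p, hp, ?_⟩
    rw [IFS.wordMap_const, Function.iterate_fixed hfix]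
  have h1 := hmem !₂[0, 0] (mem_triangle.2 (by simp)) (ext_coord (by simp) (by simp))
  have h2 := hmem !₂[1, 0] (mem_triangle.2 (by simp)) (ext_coord (by simp) (by simp))
  have := congrArg (fun v : Plane => v 0) (h1.trans h2.symm)
  simp at this

/-! ### Fibres are points or segments -/

/-- Twice the signed area of the triangle with vertices `p`, `q`, `r`. -/
noncomputable def area (p q r : Plane) : ℝ := (q 0 - p 0) * (r 1 - p 1) - (q 1 - p 1) * (r 0 - p 0)

theorem area_map (i : Fin 2) (p q r : Plane) :
    area (ifs.map i p) (ifs.map i q) (ifs.map i r) = 1 / 2 * area p q r := by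
  fin_cases i <;> simp [area] <;> ring

theorem area_wordMap : ∀ (k : ℕ) (w : Fin k → Fin 2) (p q r : Plane),
    area (ifs.wordMap k w p) (ifs.wordMap k w q) (ifs.wordMap k w r) = (1 / 2) ^ k * area p q r
  | 0, _, p, q, r => by simp [IFS.wordMap]
  | k + 1, w, p, q, r => by
    simp only [IFS.wordMap, Function.comp_apply]
    rw [area_map, area_wordMap k, pow_succ', mul_assoc]

theorem abs_area_le {p q r : Plane} (hp : p ∈ triangle) (hq : q ∈ triangle) (hr : r ∈ triangle) :
    |area p q r| ≤ 2 := by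
  rw [mem_triangle] at hp hq hr
  obtain ⟨p0, p1, p2⟩ := hp
  obtain ⟨q0, q1, q2⟩ := hq
  obtain ⟨r0, r1, r2⟩ := hr
  have h : ∀ x y u v : ℝ, 0 ≤ x → x ≤ 1 → 0 ≤ y → y ≤ 1 → 0 ≤ u → u ≤ 1 → 0 ≤ v → v ≤ 1 →
      |(x - y) * (u - v)| ≤ 1 := fun x y u v _ _ _ _ _ _ _ _ => by
    rw [abs_mul]
    exact mul_le_one₀ (abs_le.2 ⟨by linarith, by linarith⟩) (abs_nonneg _)
      (abs_le.2 ⟨by linarith, by linarith⟩)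
  unfold area
  have h1 := h (q 0) (p 0) (r 1) (p 1) (by linarith) (by linarith) (by linarith) (by linarith)
    (by linarith) (by linarith) (by linarith) (by linarith)
  have h2 := h (q 1) (p 1) (r 0) (p 0) (by linarith) (by linarith) (by linarith) (by linarith)
    (by linarith) (by linarith) (by linarith) (by linarith)
  rw [abs_le] at h1 h2 ⊢
  constructor <;> linarith [h1.1, h1.2, h2.1, h2.2]

/-- Three points of a fibre are images of points of the triangle under arbitrarily long words, and
each letter halves the area. -/
theorem area_eq_zero_of_mem_fibre {c : ℕ → Fin 2} {p q r : Plane} (hp : p ∈ ifs.fibre triangle c)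
    (hq : q ∈ ifs.fibre triangle c) (hr : r ∈ ifs.fibre triangle c) : area p q r = 0 := by
  have hle : ∀ n : ℕ, |area p q r| ≤ (1 / 2) ^ (n + 1) * 2 := by
    intro n
    obtain ⟨p', hp', rfl⟩ := mem_iInter.1 hp n
    obtain ⟨q', hq', rfl⟩ := mem_iInter.1 hq n
    obtain ⟨r', hr', rfl⟩ := mem_iInter.1 hr n
    rw [area_wordMap, abs_mul, abs_of_nonneg (by positivity : (0 : ℝ) ≤ (1 / 2) ^ (n + 1))]
    exact mul_le_mul_of_nonneg_left (abs_area_le hp' hq' hr') (by positivity)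
  have hlim : Tendsto (fun n : ℕ => (1 / 2 : ℝ) ^ (n + 1) * 2) atTop (𝓝 0) := by
    simpa using ((tendsto_pow_atTop_nhds_zero_of_lt_one (r := (1 / 2 : ℝ)) (by norm_num)
      (by norm_num)).comp (tendsto_add_atTop_nat 1)).mul_const 2
  exact abs_eq_zero.1 (le_antisymm (ge_of_tendsto' hlim hle) (abs_nonneg _))

theorem convex_map_image (i : Fin 2) {S : Set Plane} (hS : Convex ℝ S) :
    Convex ℝ (ifs.map i '' S) := by
  rintro _ ⟨x, hx, rfl⟩ _ ⟨y, hy, rfl⟩ a b ha hb hab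
  refine ⟨a • x + b • y, hS hx hy ha hb hab, ?_⟩
  fin_cases i
  · refine ext_coord ?_ ?_ <;> simp <;> ring
  · refine ext_coord ?_ ?_ <;> simp
    · ring
    · linear_combination -hab

theorem convex_wordMap_image {S : Set Plane} (hS : Convex ℝ S) :
    ∀ (k : ℕ) (w : Fin k → Fin 2), Convex ℝ (ifs.wordMap k w '' S)
  | 0, _ => by simpa [IFS.wordMap] using hS
  | k + 1, w => by
    rw [IFS.wordMap, image_comp]
    exact convex_map_image _ (convex_wordMap_image hS k _)

theorem exists_mul_eq_of_collinear {u₀ u₁ w₀ w₁ : ℝ} (hN : 0 < u₀ ^ 2 + u₁ ^ 2)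
    (h0 : u₀ * w₁ - u₁ * w₀ = 0) (h1 : w₀ ^ 2 + w₁ ^ 2 ≤ u₀ ^ 2 + u₁ ^ 2)
    (h2 : (w₀ - u₀) ^ 2 + (w₁ - u₁) ^ 2 ≤ u₀ ^ 2 + u₁ ^ 2) :
    ∃ t, 0 ≤ t ∧ t ≤ 1 ∧ t * u₀ = w₀ ∧ t * u₁ = w₁ := by
  obtain ⟨t, rfl, rfl⟩ : ∃ t, t * u₀ = w₀ ∧ t * u₁ = w₁ := by
    -- The coefficient of the orthogonal projection of `w` onto `u`; the distance bounds then read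
    -- `t² ≤ 1` and `(1 - t)² ≤ 1`.
    refine ⟨(u₀ * w₀ + u₁ * w₁) / (u₀ ^ 2 + u₁ ^ 2), ?_, ?_⟩
    · rw [div_mul_eq_mul_div, div_eq_iff hN.ne']
      linear_combination u₁ * h0
    · rw [div_mul_eq_mul_div, div_eq_iff hN.ne']
      linear_combination -u₀ * h0
  have g1 : t ^ 2 ≤ 1 := le_of_mul_le_mul_right (by linarith) hN
  have g2 : (1 - t) ^ 2 ≤ 1 := le_of_mul_le_mul_right (by linarith) hN
  exact ⟨t, by nlinarith, by nlinarith, rfl, rfl⟩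

/-- A compact convex set of collinear points is a point or a segment. -/
theorem eq_singleton_or_segment {K : Set Plane} (hK : IsCompact K) (hconv : Convex ℝ K)
    (hne : K.Nonempty) (harea : ∀ p ∈ K, ∀ q ∈ K, ∀ r ∈ K, area p q r = 0) :
    (∃ a, K = {a}) ∨ ∃ a b, a ≠ b ∧ K = segment ℝ a b := by
  -- A pair realizing the diameter serves as the endpoints.
  obtain ⟨a, ha, b, hb, hle⟩ : ∃ a ∈ K, ∃ b ∈ K, ∀ x ∈ K, ∀ y ∈ K, dist x y ≤ dist a b := by
    obtain ⟨x, hx, hmax⟩ := (hK.prod hK).exists_isMaxOn (hne.prod hne)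
      (f := fun x : Plane × Plane => dist x.1 x.2) continuous_dist.continuousOn
    exact ⟨x.1, hx.1, x.2, hx.2, fun y hy z hz => isMaxOn_iff.1 hmax (y, z) ⟨hy, hz⟩⟩
  by_cases hab : a = b
  · subst hab
    refine Or.inl ⟨a, eq_singleton_iff_unique_mem.2 ⟨ha, fun x hx => ?_⟩⟩
    have := hle x hx a ha
    rw [dist_self] at this
    exact dist_le_zero.1 this
  · refine Or.inr ⟨a, b, hab, Subset.antisymm (fun c hc => ?_) (hconv.segment_subset ha hb)⟩
    have hN : 0 < dist a b ^ 2 := pow_pos (dist_pos.2 hab) 2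
    have h1 := pow_le_pow_left₀ dist_nonneg (hle c hc a ha) 2
    have h2 := pow_le_pow_left₀ dist_nonneg (hle c hc b hb) 2
    rw [dist_comm a b, dist_sq_eq] at hN h1 h2
    rw [dist_sq_eq] at h1 h2
    obtain ⟨t, ht0, ht1, e0, e1⟩ := exists_mul_eq_of_collinear hN (harea a ha b hb c hc) h1
      (by rwa [sub_sub_sub_cancel_right, sub_sub_sub_cancel_right])
    refine ⟨1 - t, t, by linarith, ht0, by ring, ext_coord ?_ ?_⟩ <;> simp <;> linarith

theorem fibre_eq_singleton_or_segment (c : ℕ → Fin 2) :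
    (∃ a, ifs.fibre triangle c = {a}) ∨
      ∃ a b, a ≠ b ∧ ifs.fibre triangle c = segment ℝ a b :=
  eq_singleton_or_segment (ifs.isCompact_fibre isCompact_triangle c)
    (convex_iInter fun _ => convex_wordMap_image convex_triangle _ _)
    (ifs.fibre_nonempty mapsTo_triangle isCompact_triangle ⟨_, fixedPt_mem⟩ c)
    fun _ hp _ hq _ hr => area_eq_zero_of_mem_fibre hp hq hr

/-! ### The triangle as an attractor -/

theorem isMinimalInvariant_triangle : ifs.IsMinimalInvariant triangle :=
  ⟨isInvariant_triangle, fun _ hC hsub =>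
    hsub.ne (eq_triangle_of_mapsTo hsub.subset hC.2.1 hC.1 hC.mapsTo)⟩

theorem isSemiattractor_triangle : ifs.IsSemiattractor triangle := by
  refine ⟨isInvariant_triangle.1, isCompact_triangle.isClosed, Subset.antisymm ?_ ?_⟩
  · exact (iInter_subset _ fixedPt).trans (IFS.lowerKuratowskiLimit_subset
      isCompact_triangle.isClosed (ifs.hutchinson_iterate_subset isCompact_triangle.isClosed
        mapsTo_triangle (singleton_subset_iff.2 fixedPt_mem)))
  · exact subset_iInter fun x => ifs.subset_lowerKuratowskiLimit isCompact_triangle.isClosed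
      mapsTo_triangle (fun C h1 h2 h3 h4 => eq_triangle_of_mapsTo h1 h2 h3 h4) fixedPt_mem
      (tendsto_map_one_iterate x)

theorem isStrictAttractor_restrict (h : ∀ i, MapsTo (ifs.map i) triangle triangle) :
    (ifs.restrict triangle h).IsStrictAttractor univ := by
  have : CompactSpace triangle := isCompact_iff_compactSpace.1 isCompact_triangle
  refine ⟨⟨⟨_, fixedPt_mem⟩, trivial⟩, isClosed_univ, univ, isOpen_univ, Subset.rfl,
    fun S hS _ _ => ?_⟩
  refine tendsto_hausdorffEDist_of_subset_lowerKuratowskiLimit isCompact_univ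
    (fun n => IFS.hutchinson_iterate_nonempty _ hS n) (fun n => subset_univ _) ?_
  obtain ⟨x, hx⟩ := hS
  have hx' := singleton_subset_iff.2 hx
  have hsub : univ ⊆ lowerKuratowskiLimit
      fun n => (ifs.restrict triangle h).hutchinson^[n] {x} := by
    refine (ifs.restrict triangle h).subset_lowerKuratowskiLimit (j := 1) isClosed_univ
      (fun i => mapsTo_univ _ _) (fun C _ hC hne hmaps => ?_) (mem_univ ⟨fixedPt, fixedPt_mem⟩) ?_
    -- Rigidity is a statement in the plane, so `C` is pushed forward along the closed embedding.
    · have himg : Subtype.val '' C = triangle := by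
        refine eq_triangle_of_mapsTo (by simp)
          (isCompact_triangle.isClosed.isClosedEmbedding_subtypeVal.isClosedMap _ hC)
          (hne.image _) ?_
        rintro i _ ⟨y, hy, rfl⟩
        exact ⟨_, hmaps i hy, rfl⟩
      refine eq_univ_of_forall fun y => ?_
      obtain ⟨y', hy', hyy⟩ := himg.symm.subset y.2
      exact Subtype.ext hyy ▸ hy'
    · rw [tendsto_subtype_rng]
      refine (tendsto_map_one_iterate x).congr fun n => ?_
      change _ = (((h 1).restrict)^[n] x : Plane)
      rw [MapsTo.iterate_restrict]
      rfl
  refine hsub.trans ?_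
  rintro y ⟨u, hu, hlim⟩
  exact ⟨u, fun n hn => IFS.hutchinson_iterate_mono _ hx' n (hu n hn), hlim⟩

end BarnsleyVince

/-! ### The main theorem -/

theorem mainTheorem4 :
    -- the triangle is a compact minimal invariant set and a semiattractor on the whole plane
    (IsCompact BarnsleyVince.triangle ∧
      BarnsleyVince.ifs.IsMinimalInvariant BarnsleyVince.triangle ∧
      BarnsleyVince.ifs.IsSemiattractor BarnsleyVince.triangle) ∧
    -- it is the strict attractor of the restricted system
    (∃ h : ∀ i, Set.MapsTo (BarnsleyVince.ifs.map i) BarnsleyVince.triangle BarnsleyVince.triangle,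
      (BarnsleyVince.ifs.restrict BarnsleyVince.triangle h).IsStrictAttractor Set.univ) ∧
    -- fibre structure
    BarnsleyVince.ifs.IsStronglyFibred BarnsleyVince.triangle ∧
    ¬ BarnsleyVince.ifs.IsPointFibred BarnsleyVince.triangle ∧
    (∀ c : ℕ → Fin 2,
      (∃ a, BarnsleyVince.ifs.fibre BarnsleyVince.triangle c = {a}) ∨
      (∃ a b, a ≠ b ∧ BarnsleyVince.ifs.fibre BarnsleyVince.triangle c = segment ℝ a b)) ∧
    -- equal probabilities: the second iterate is contractive on average, and normalized Lebesgue
    -- measure is the unique invariant probability measure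
    (∀ (p : Fin 2 → ℝ≥0) (hp : ∑ i, p i = 1), p 0 = 1 / 2 → p 1 = 1 / 2 →
      ((BarnsleyVince.probIFS p hp).iterate 2).IsAverageContractive ∧
      (BarnsleyVince.probIFS p hp).IsInvariantMeasure BarnsleyVince.lebesgueTriangle ∧
      (∀ ν : Measure (EuclideanSpace ℝ (Fin 2)),
        (BarnsleyVince.probIFS p hp).IsInvariantMeasure ν → ν = BarnsleyVince.lebesgueTriangle) ∧
      BarnsleyVince.lebesgueTriangle.support = BarnsleyVince.triangle) ∧
    -- other probabilities with `p₁` below the explicit threshold, approximately 0.53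
    (∀ (p : Fin 2 → ℝ≥0) (hp : ∑ i, p i = 1),
      (p 0 : ℝ) < (4 - 2 * √2) / (√(3 * √17 + 13) - 2 * √2) →
      ((BarnsleyVince.probIFS p hp).iterate 2).IsAverageContractive ∧
      ∃ μ : Measure (EuclideanSpace ℝ (Fin 2)),
        (BarnsleyVince.probIFS p hp).IsInvariantMeasure μ ∧
        (∀ ν : Measure (EuclideanSpace ℝ (Fin 2)),
          (BarnsleyVince.probIFS p hp).IsInvariantMeasure ν → ν = μ) ∧
        μ BarnsleyVince.triangleᶜ = 0 ∧
        (0 < p 0 → μ.support = BarnsleyVince.triangle)) := by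
  open BarnsleyVince in
  refine ⟨⟨isCompact_triangle, isMinimalInvariant_triangle, isSemiattractor_triangle⟩,
    ⟨mapsTo_triangle, isStrictAttractor_restrict _⟩, isStronglyFibred_triangle,
    not_isPointFibred_triangle, fibre_eq_singleton_or_segment, fun p hp h0 h1 => ?_,
    fun p hp hlt => ?_⟩
  · have hcontr := BarnsleyVince.isAverageContractive_half p hp h0 h1
    have hinv := BarnsleyVince.isInvariantMeasure_lebesgueTriangle p hp h0 h1
    refine ⟨hcontr, hinv, fun ν hν =>
      ProbIFS.isInvariantMeasure_unique_of_iterate_two _ hcontr hν hinv,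
      BarnsleyVince.support_eq_triangle p hp (fun i => ?_) hinv
        BarnsleyVince.lebesgueTriangle_compl⟩
    fin_cases i <;> simp [h0, h1]
  · have hp' : (p 1 : ℝ) = 1 - p 0 := by
      rw [Fin.sum_univ_two] at hp
      rw [eq_sub_iff_add_eq']
      exact_mod_cast hp
    rw [BarnsleyVince.lt_threshold_iff, ← hp'] at hlt
    have hcontr := BarnsleyVince.isAverageContractive_iterate_two p hp hlt
    obtain ⟨μ, hμ, hμC⟩ := (BarnsleyVince.probIFS p hp).exists_isInvariantMeasure_of_iterate_two
      hcontr BarnsleyVince.isCompact_triangle BarnsleyVince.isInvariant_triangle.1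
      BarnsleyVince.mapsTo_triangle
    refine ⟨hcontr, μ, hμ, fun ν hν =>
      ProbIFS.isInvariantMeasure_unique_of_iterate_two _ hcontr hν hμ, hμC, fun h0 =>
      BarnsleyVince.support_eq_triangle p hp (fun i => ?_) hμ hμC⟩
    -- If `p 1` vanished, contractivity would read `lipBound 0 < 1`, which is false.
    have h1 : 0 < p 1 := by
      refine pos_iff_ne_zero.2 fun h1 => ?_
      have := BarnsleyVince.lipBound_zero_bounds.1
      rw [h1, NNReal.coe_zero] at hp' hlt
      have h01 : (p 0 : ℝ) = 1 := by linarith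
      rw [h01] at hlt
      linarith
    fin_cases i
    exacts [h0, h1]
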